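/- Let $H$ be a finite splitgraph with vertex set partitioned into a clique $C$ and an independent set $I$. A birdcage-split is a graph obtained from such an $H$ by replacing every edge between $C$ and $I$ by a path of length greater than one, so that for each $x \in I$ the paths that replace the edges incident with $x$ either all have even length or all have odd length. Replacing each of these edges by a path of length two, that is, subdividing every edge between $C$ and $I$ by a single vertex, gives in particular a birdcage-split, which we denote by $H^{\ast}$. Theorem. For every natural number $t$ there is a finite splitgraph $H$, with clique $C$ and independent set $I$, such that the birdcage-split $H^{\ast}$ has cliquewidth greater than $t$. Moreover, $H^{\ast}$ has no even hole (no induced cycle of even length at least four) and no diamond (no induced $K_4-e$), and $H$ is a vertex-minor of $H^{\ast}$, that is, $H$ is isomorphic to an induced subgraph of a graph obtained from $H^{\ast}$ by a sequence of local complementations. Here the local complementation at a vertex $z$ complements the adjacency between any two distinct neighbours of $z$. The cliquewidth of a finite non-empty graph is the least $k$ such that the graph can be constructed, with vertex labels $1,\dots,k$, by the following operations: creating a single labelled vertex; adding all edges between the vertices with label $i$ and the vertices with label $j$, for $i \neq j$; changing every label $i$ into $j$; and taking the disjoint union of two labelled graphs. -/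

import Mathlib

namespace SimpleGraph

universe u v

/-- A graph together with a labelling of its vertices by `k` labels. -/
structure LabeledGraph (k : ℕ) where
  /-- the vertices -/
  Vert : Type
  /-- the underlying graph -/
  graph : SimpleGraph Vert
  /-- the label of each vertex -/
  label : Vert → Fin k

namespace LabeledGraph

/-- `i(x)`: the graph with a single vertex, labelled `i`. -/
def single {k : ℕ} (i : Fin k) : LabeledGraph k where
  Vert := Unit
  graph := ⊥
  label := fun _ => i

/-- `η_{i,j}` for distinct `i`, `j`: add all edges between label `i` and label `j`. -/
def join {k : ℕ} (i j : Fin k) (hij : i ≠ j) (A : LabeledGraph k) : LabeledGraph k where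
  Vert := A.Vert
  graph :=
    { Adj := fun a b => A.graph.Adj a b ∨
        (A.label a = i ∧ A.label b = j) ∨ (A.label a = j ∧ A.label b = i)
      symm := ⟨by
        rintro a b (h | ⟨h₁, h₂⟩ | ⟨h₁, h₂⟩)
        · exact Or.inl h.symm
        · exact Or.inr (Or.inr ⟨h₂, h₁⟩)
        · exact Or.inr (Or.inl ⟨h₂, h₁⟩)⟩
      loopless := ⟨by
        rintro a (h | ⟨h₁, h₂⟩ | ⟨h₁, h₂⟩)
        · exact h.ne rfl
        · exact hij (h₁.symm.trans h₂)
        · exact hij (h₂.symm.trans h₁)⟩ }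
  label := A.label

/-- `ρ_{i → j}`: give label `j` to every vertex that has label `i`. -/
def relabel {k : ℕ} (i j : Fin k) (A : LabeledGraph k) : LabeledGraph k where
  Vert := A.Vert
  graph := A.graph
  label := fun a => if A.label a = i then j else A.label a

/-- The disjoint union of two labelled graphs. -/
def disjointUnion {k : ℕ} (A B : LabeledGraph k) : LabeledGraph k where
  Vert := A.Vert ⊕ B.Vert
  graph := A.graph ⊕g B.graph
  label := Sum.elim A.label B.label

end LabeledGraph

/-- The `k`-expressions, that is, the terms in the `k`-composers. -/
inductive CliqueExpr (k : ℕ) : Type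
  | single (i : Fin k) : CliqueExpr k
  | join (i j : Fin k) (hij : i ≠ j) (e : CliqueExpr k) : CliqueExpr k
  | relabel (i j : Fin k) (e : CliqueExpr k) : CliqueExpr k
  | disjointUnion (e f : CliqueExpr k) : CliqueExpr k

/-- The labelled graph that a `k`-expression constructs. -/
def CliqueExpr.eval {k : ℕ} : CliqueExpr k → LabeledGraph k
  | .single i => LabeledGraph.single i
  | .join i j hij e => LabeledGraph.join i j hij e.eval
  | .relabel i j e => LabeledGraph.relabel i j e.eval
  | .disjointUnion e f => LabeledGraph.disjointUnion e.eval f.eval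

/-- `G` is (up to isomorphism) constructed by some `k`-expression. -/
def HasCliqueExpr {V : Type u} (G : SimpleGraph V) (k : ℕ) : Prop :=
  ∃ e : CliqueExpr k, Nonempty (G ≃g e.eval.graph)

/-- The cliquewidth of a finite graph: the least `k` such that some `k`-expression constructs it.
(Every finite non-empty graph has a `k`-expression for some `k`. The value is `0` for the empty
graph and, as a junk value, for infinite graphs.) -/
noncomputable def cliqueWidth {V : Type u} (G : SimpleGraph V) : ℕ :=
  sInf {k : ℕ | G.HasCliqueExpr k}

/-- `G` has an even hole: an induced cycle of even length at least four. -/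
def HasEvenHole {V : Type u} (G : SimpleGraph V) : Prop :=
  ∃ n : ℕ, 4 ≤ n ∧ Even n ∧ (cycleGraph n).IsIndContained G

/-- The diamond `K₄ - e`. -/
def diamond : SimpleGraph (Fin 4) :=
  (completeGraph (Fin 4)).deleteEdges {s(0, 1)}

/-- `G` has a diamond as an induced subgraph. -/
def HasDiamond {V : Type u} (G : SimpleGraph V) : Prop :=
  diamond.IsIndContained G

/-- `H` is a splitgraph `H(C, I, E)`: its vertices are partitioned into the clique `C` and the
independent set `I`. -/
structure IsSplit {V : Type u} (H : SimpleGraph V) (C I : Set V) : Prop where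
  isCompl : IsCompl C I
  isClique : H.IsClique C
  isIndepSet : H.IsIndepSet I

/-- The inner vertices of the paths that replace the edges between `C` and `I`: `(c, x, i)` is the
vertex at distance `i` from `c` on the path of length `ℓ c x` that replaces the edge `cx`. -/
def PathVertex {V : Type u} (H : SimpleGraph V) (C I : Set V) (ℓ : V → V → ℕ) : Type u :=
  {p : V × V × ℕ // p.1 ∈ C ∧ p.2.1 ∈ I ∧ H.Adj p.1 p.2.1 ∧ 0 < p.2.2 ∧ p.2.2 < ℓ p.1 p.2.1}

/-- The inner path vertex `p` is a neighbour of the old vertex `v`: it is the first vertex of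
its path and `v` is the end in `C`, or it is the last one and `v` is the end in `I`. -/
def PathVertex.Attached {V : Type u} {H : SimpleGraph V} {C I : Set V} {ℓ : V → V → ℕ}
    (p : PathVertex H C I ℓ) (v : V) : Prop :=
  (v = p.1.1 ∧ p.1.2.2 = 1) ∨ (v = p.1.2.1 ∧ p.1.2.2 + 1 = ℓ p.1.1 p.1.2.1)

/-- The inner path vertices `p` and `q` are consecutive on a common path. -/
def PathVertex.Consecutive {V : Type u} {H : SimpleGraph V} {C I : Set V} {ℓ : V → V → ℕ}
    (p q : PathVertex H C I ℓ) : Prop :=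
  p.1.1 = q.1.1 ∧ p.1.2.1 = q.1.2.1 ∧ (p.1.2.2 + 1 = q.1.2.2 ∨ q.1.2.2 + 1 = p.1.2.2)

/-- The graph obtained from the splitgraph `H(C, I, E)` by replacing every edge `cx` with `c ∈ C`
and `x ∈ I` by a path of length `ℓ c x`, where all lengths are at least two. -/
def replaceByPaths {V : Type u} (H : SimpleGraph V) (C I : Set V) (ℓ : V → V → ℕ) :
    SimpleGraph (V ⊕ PathVertex H C I ℓ) where
  Adj
    | .inl u, .inl v => H.Adj u v ∧ u ∈ C ∧ v ∈ C
    | .inl u, .inr p => p.Attached u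
    | .inr p, .inl u => p.Attached u
    | .inr p, .inr q => p.Consecutive q
  symm := ⟨by
    rintro (u | p) (v | q) h
    · exact ⟨h.1.symm, h.2.2, h.2.1⟩
    · exact h
    · exact h
    · exact ⟨h.1.symm, h.2.1.symm, h.2.2.symm⟩⟩
  loopless := ⟨by
    rintro (u | p) h
    · exact h.1.ne rfl
    · rcases h.2.2 with h | h <;> omega⟩

/-- The graph obtained from the splitgraph `H(C, I, E)` by subdividing every edge between `C`
and `I` by a single vertex. -/
abbrev subdivideCross {V : Type u} (H : SimpleGraph V) (C I : Set V) :
    SimpleGraph (V ⊕ PathVertex H C I (fun _ _ => 2)) :=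
  H.replaceByPaths C I (fun _ _ => 2)

/-- `G` is a birdcage-split: it is obtained from a finite splitgraph `H(C, I, E)` by replacing the
edges between `C` and `I` by paths of length greater than one such that, for each `x ∈ I`, the
paths that end in `x` either all have even length or all have odd length. -/
def IsBirdcageSplit {W : Type u} (G : SimpleGraph W) : Prop :=
  ∃ (V : Type) (_ : Finite V) (H : SimpleGraph V) (C I : Set V) (ℓ : V → V → ℕ),
    H.IsSplit C I ∧
    (∀ c ∈ C, ∀ x ∈ I, H.Adj c x → 1 < ℓ c x) ∧
    (∀ x ∈ I, (∀ c ∈ C, H.Adj c x → Even (ℓ c x)) ∨ (∀ c ∈ C, H.Adj c x → Odd (ℓ c x))) ∧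
    Nonempty (G ≃g H.replaceByPaths C I ℓ)

/-- Local complementation at `z`: adjacency is complemented between any two distinct neighbours
of `z`. -/
def localComplement {V : Type u} (G : SimpleGraph V) (z : V) : SimpleGraph V where
  Adj a b := a ≠ b ∧ Xor (G.Adj a b) (G.Adj z a ∧ G.Adj z b)
  symm := ⟨by
    rintro a b ⟨hab, h⟩
    refine ⟨hab.symm, ?_⟩
    rwa [G.adj_comm b a, and_comm (a := G.Adj z b)]⟩
  loopless := ⟨fun _ h => h.1 rfl⟩

/-- `H` is a vertex-minor of `G`: it is isomorphic to an induced subgraph of a graph obtained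
from `G` by a sequence of local complementations. -/
def IsVertexMinor {V : Type u} {W : Type v} (H : SimpleGraph V) (G : SimpleGraph W) : Prop :=
  ∃ l : List W, H.IsIndContained (l.foldl localComplement G)

end SimpleGraph

/-! Take the complete splitgraph with `n = 4 * t + 4` vertices on each side; its subdivision
vertices form an `n × n` array. From an expression with `k` labels one obtains a vertex set `S` that
contains a moderate share of the array and whose members fall into at most `k` classes with equal
neighbourhoods outside `S` (`CliqueExpr.exists_balanced`). A clique vertex sees exactly its row of
the array and an independent vertex exactly its column, so `S` splits at most `2k` rows and `2k`
columns (`HasCutClasses.card_split_le`). Hence `S` or its complement contains at most `4k²` entries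
(`ncard_le_of_few_split`), which the balance forbids when `k ≤ t`.

The other claims hold for every splitgraph. All triangles lie in the clique, which excludes
diamonds. A hole has to pass through the independent set, and the clique then closes it up to length
five. Complementing at a subdivision vertex, which has degree two, restores the edge it replaced. -/

namespace SimpleGraph

universe u

/-! ### Holes, diamonds and local complementations in the subdivided splitgraph. -/

section SubdivideCross

variable {V : Type u} {H : SimpleGraph V} {C I : Set V}

theorem IsSplit.notMem_left (hs : H.IsSplit C I) {x : V} (hx : x ∈ I) : x ∉ C := fun hc =>
  Set.disjoint_left.1 hs.isCompl.disjoint hc hx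

theorem IsSplit.mem_or_mem (hs : H.IsSplit C I) (x : V) : x ∈ C ∨ x ∈ I := by
  have h : x ∈ C ∪ I := by
    rw [show C ∪ I = Set.univ from hs.isCompl.sup_eq_top]
    trivial
  exact h

theorem PathVertex.index_eq_one (p : PathVertex H C I (fun _ _ => 2)) : p.1.2.2 = 1 := by
  obtain ⟨h₁, h₂⟩ := p.2.2.2.2
  exact le_antisymm (Nat.lt_succ_iff.1 h₂) h₁

theorem PathVertex.ext_ends {p q : PathVertex H C I (fun _ _ => 2)} (h₁ : p.1.1 = q.1.1)
    (h₂ : p.1.2.1 = q.1.2.1) : p = q :=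
  Subtype.ext (Prod.ext h₁ (Prod.ext h₂ (p.index_eq_one.trans q.index_eq_one.symm)))

theorem subdivideCross_adj_inl_inl {u v : V} :
    (H.subdivideCross C I).Adj (.inl u) (.inl v) ↔ H.Adj u v ∧ u ∈ C ∧ v ∈ C := Iff.rfl

theorem subdivideCross_adj_inr_inl {p : PathVertex H C I (fun _ _ => 2)} {u : V} :
    (H.subdivideCross C I).Adj (.inr p) (.inl u) ↔ u = p.1.1 ∨ u = p.1.2.1 := by
  change p.Attached u ↔ _
  simp [PathVertex.Attached, p.index_eq_one]

theorem not_subdivideCross_adj_inr_inr {p q : PathVertex H C I (fun _ _ => 2)} :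
    ¬ (H.subdivideCross C I).Adj (.inr p) (.inr q) := by
  rintro ⟨-, -, h⟩
  have := p.index_eq_one
  have := q.index_eq_one
  omega

theorem subdivideCross_adj_inr {p : PathVertex H C I (fun _ _ => 2)}
    {w : V ⊕ PathVertex H C I (fun _ _ => 2)} :
    (H.subdivideCross C I).Adj (.inr p) w ↔ w = .inl p.1.1 ∨ w = .inl p.1.2.1 := by
  cases w with
  | inl u => simp [subdivideCross_adj_inr_inl]
  | inr q => simpa using not_subdivideCross_adj_inr_inr

theorem IsSplit.eq_inr_of_subdivideCross_adj (hs : H.IsSplit C I) {x : V} (hx : x ∈ I)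
    {w : V ⊕ PathVertex H C I (fun _ _ => 2)} (h : (H.subdivideCross C I).Adj (.inl x) w) :
    ∃ p, w = .inr p ∧ p.1.2.1 = x := by
  cases w with
  | inl u => exact absurd h.2.1 (hs.notMem_left hx)
  | inr p =>
    refine ⟨p, rfl, ?_⟩
    rcases subdivideCross_adj_inr_inl.1 h.symm with h | h
    · exact absurd (h ▸ p.2.1) (hs.notMem_left hx)
    · exact h.symm

theorem IsSplit.isBirdcageSplit_subdivideCross {V : Type} [Finite V] {H : SimpleGraph V}
    {C I : Set V} (hs : H.IsSplit C I) : (H.subdivideCross C I).IsBirdcageSplit :=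
  ⟨V, ‹_›, H, C, I, fun _ _ => 2, hs, fun _ _ _ _ _ => one_lt_two,
    fun _ _ => Or.inl fun _ _ _ => even_two, ⟨Iso.refl⟩⟩

/-- A subdivision vertex has only two neighbours, one in `C` and one in `I`, and these are no longer
adjacent; a vertex of `I` sees only subdivision vertices. -/
theorem IsSplit.mem_clique_of_triangle (hs : H.IsSplit C I)
    {a b c : V ⊕ PathVertex H C I (fun _ _ => 2)} (hab : (H.subdivideCross C I).Adj a b)
    (hac : (H.subdivideCross C I).Adj a c) (hbc : (H.subdivideCross C I).Adj b c) :
    ∃ u ∈ C, a = .inl u := by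
  have key : ∀ {p : PathVertex H C I (fun _ _ => 2)} {b c},
      (H.subdivideCross C I).Adj (.inr p) b → (H.subdivideCross C I).Adj (.inr p) c →
      ¬ (H.subdivideCross C I).Adj b c := by
    intro p b c hb hc hbc
    have hx := hs.notMem_left p.2.2.1
    rcases subdivideCross_adj_inr.1 hb with rfl | rfl <;>
      rcases subdivideCross_adj_inr.1 hc with rfl | rfl
    · exact hbc.ne rfl
    · exact hx hbc.2.2
    · exact hx hbc.2.1
    · exact hbc.ne rfl
  cases a with
  | inr p => exact absurd hbc (key hab hac)
  | inl u =>
    cases b with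
    | inr p => exact absurd hac (key hab.symm hbc)
    | inl v => exact ⟨u, hab.2.1, rfl⟩

theorem IsSplit.not_hasDiamond_subdivideCross (hs : H.IsSplit C I) :
    ¬ (H.subdivideCross C I).HasDiamond := by
  rintro ⟨f⟩
  have hadj : ∀ i j : Fin 4, i ≠ j → s(i, j) ≠ s(0, 1) →
      (H.subdivideCross C I).Adj (f i) (f j) := by
    intro i j h₁ h₂
    refine f.map_adj_iff.2 ?_
    simp only [diamond, deleteEdges_adj, Set.mem_singleton_iff]
    exact ⟨h₁, h₂⟩
  obtain ⟨u, hu, hfu⟩ := hs.mem_clique_of_triangle (hadj 0 2 (by decide) (by decide))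
    (hadj 0 3 (by decide) (by decide)) (hadj 2 3 (by decide) (by decide))
  obtain ⟨v, hv, hfv⟩ := hs.mem_clique_of_triangle (hadj 1 2 (by decide) (by decide))
    (hadj 1 3 (by decide) (by decide)) (hadj 2 3 (by decide) (by decide))
  have huv : u ≠ v := by
    rintro rfl
    exact absurd (f.injective (hfu.trans hfv.symm)) (by decide)
  have h01 : (H.subdivideCross C I).Adj (f 0) (f 1) := by
    rw [hfu, hfv]
    exact ⟨hs.isClique hu hv huv, hu, hv⟩
  have := f.map_adj_iff.1 h01
  simp [diamond] at this

open scoped Fin.CommRing in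
theorem IsSplit.not_hasEvenHole_subdivideCross (hs : H.IsSplit C I) :
    ¬ (H.subdivideCross C I).HasEvenHole := by
  rintro ⟨n, hn, heven, ⟨f⟩⟩
  obtain ⟨m, rfl⟩ := Nat.exists_eq_add_of_le' hn
  have hcast : ∀ a : ℕ, ((a : Fin (m + 4)) = 0) ↔ m + 4 ∣ a := fun a => Fin.natCast_eq_zero
  have hsucc : ∀ i, (H.subdivideCross C I).Adj (f i) (f (i + 1)) := fun i =>
    f.map_adj_iff.2 (cycleGraph_adj.2 (Or.inr (by ring)))
  have hpred : ∀ i, (H.subdivideCross C I).Adj (f i) (f (i - 1)) := fun i =>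
    f.map_adj_iff.2 (cycleGraph_adj.2 (Or.inl (by ring)))
  have htwo : (2 : Fin (m + 4)) ≠ 0 := by
    intro h
    have := Nat.le_of_dvd (by norm_num) ((hcast 2).1 (by exact_mod_cast h))
    omega
  have hne : ∀ i, f (i + 1) ≠ f (i - 1) := by
    intro i h
    have := f.injective h
    exact htwo (by linear_combination this)
  obtain ⟨i, x, hx, hi⟩ : ∃ i, ∃ x ∈ I, f i = .inl x := by
    -- A subdivision vertex on the hole has a hole neighbour in `I`. A hole avoiding `I` therefore
    -- lies in the clique, and the vertices at positions `1` and `-1` would be adjacent.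
    by_contra! hI
    have hC : ∀ i, ∃ c ∈ C, f i = .inl c := by
      intro i
      cases h : f i with
      | inl c => exact ⟨c, (hs.mem_or_mem c).resolve_right fun hc => hI i c hc h, rfl⟩
      | inr p =>
        have h₁ := subdivideCross_adj_inr.1 (h ▸ hsucc i)
        have h₂ := subdivideCross_adj_inr.1 (h ▸ hpred i)
        rcases h₁ with h₁ | h₁
        · rcases h₂ with h₂ | h₂
          · exact absurd (h₁.trans h₂.symm) (hne i)
          · exact absurd h₂ (hI _ _ p.2.2.1)
        · exact absurd h₁ (hI _ _ p.2.2.1)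
    obtain ⟨c, hc, h₁⟩ := hC (0 + 1)
    obtain ⟨d, hd, h₂⟩ := hC (0 - 1)
    have hcd : c ≠ d := by
      rintro rfl
      exact hne 0 (h₁.trans h₂.symm)
    have hadj : (H.subdivideCross C I).Adj (f (0 + 1)) (f (0 - 1)) := by
      rw [h₁, h₂]
      exact ⟨hs.isClique hc hd hcd, hc, hd⟩
    rcases cycleGraph_adj.1 (f.map_adj_iff.1 hadj) with h | h
    · have := Nat.le_of_dvd (by norm_num)
        ((hcast 1).1 (by push_cast; linear_combination h))
      omega
    · have := Nat.le_of_dvd (by norm_num)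
        ((hcast 3).1 (by push_cast; linear_combination -h))
      omega
  obtain ⟨p, hp, hpx⟩ := hs.eq_inr_of_subdivideCross_adj hx (hi ▸ hsucc i)
  obtain ⟨q, hq, hqx⟩ := hs.eq_inr_of_subdivideCross_adj hx (hi ▸ hpred i)
  -- The hole cannot turn back to `x`, so it leaves the subdivision vertex through its clique end.
  have hpc : f (i + 1 + 1) = .inl p.1.1 := by
    refine (subdivideCross_adj_inr.1 (hp ▸ hsucc (i + 1))).resolve_right fun h => ?_
    refine hne (i + 1) ?_
    rw [h, hpx, add_sub_cancel_right, hi]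
  have hqc : f (i - 1 - 1) = .inl q.1.1 := by
    refine (subdivideCross_adj_inr.1 (hq ▸ hpred (i - 1))).resolve_right fun h => ?_
    refine hne (i - 1) ?_
    rw [h, hqx, sub_add_cancel, hi]
  have hpq : p.1.1 ≠ q.1.1 := fun h =>
    hne i (by rw [hp, hq, PathVertex.ext_ends h (hpx.trans hqx.symm)])
  have hadj : (H.subdivideCross C I).Adj (f (i + 1 + 1)) (f (i - 1 - 1)) := by
    rw [hpc, hqc]
    exact ⟨hs.isClique p.2.1 q.2.1 hpq, p.2.1, q.2.1⟩
  -- Positions `i + 2` and `i - 2` are consecutive, so the length divides 3 or 5; only here is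
  -- evenness used.
  rcases cycleGraph_adj.1 (f.map_adj_iff.1 hadj) with h | h
  · have h3 := (hcast 3).1 (by push_cast; linear_combination h)
    have := Nat.le_of_dvd (by norm_num) h3
    omega
  · have h5 := (hcast 5).1 (by push_cast; linear_combination -h)
    have := (heven.two_dvd).trans h5
    omega

/-- Subdivision vertices are pairwise nonadjacent, so complementing at one of them keeps the
neighbourhoods of all and toggles a single pair. Without repetitions in `l`, no restored edge is
toggled away again. -/
theorem foldl_localComplement_subdivideCross (hs : H.IsSplit C I)
    (l : List (PathVertex H C I (fun _ _ => 2))) (hl : l.Nodup) :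
    (∀ p w, ((l.map Sum.inr).foldl localComplement (H.subdivideCross C I)).Adj (.inr p) w ↔
      (H.subdivideCross C I).Adj (.inr p) w) ∧
    ∀ u v, ((l.map Sum.inr).foldl localComplement (H.subdivideCross C I)).Adj (.inl u) (.inl v) ↔
      (H.Adj u v ∧ u ∈ C ∧ v ∈ C) ∨
        ∃ p ∈ l, (u = p.1.1 ∧ v = p.1.2.1) ∨ (u = p.1.2.1 ∧ v = p.1.1) := by
  induction l using List.reverseRecOn with
  | nil => simp [subdivideCross_adj_inl_inl]
  | append_singleton l q ih =>
    have hq : q ∉ l := by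
      rw [List.nodup_append] at hl
      exact fun h => hl.2.2 q h q (by simp) rfl
    obtain ⟨ih₁, ih₂⟩ := ih (List.nodup_append.1 hl).1
    simp only [List.map_append, List.map_cons, List.map_nil, List.foldl_append, List.foldl_cons,
      List.foldl_nil]
    set G := (l.map Sum.inr).foldl localComplement (H.subdivideCross C I)
    have hne : q.1.1 ≠ q.1.2.1 := q.2.2.2.1.ne
    constructor
    · intro p w
      rw [← ih₁]
      constructor
      · rintro ⟨-, h | h⟩
        · exact h.1
        · exact absurd ((ih₁ _ _).1 h.1.1) not_subdivideCross_adj_inr_inr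
      · exact fun h => ⟨h.ne, Or.inl ⟨h, fun h' =>
          not_subdivideCross_adj_inr_inr ((ih₁ _ _).1 h'.1)⟩⟩
    · intro u v
      have hxC := hs.notMem_left q.2.2.1
      have hnot : ∀ {u v}, u = q.1.1 → v = q.1.2.1 → ¬ G.Adj (.inl u) (.inl v) := by
        rintro u v rfl rfl h
        rcases (ih₂ _ _).1 h with h | ⟨p, hp, h | h⟩
        · exact hxC h.2.2
        · exact hq (PathVertex.ext_ends h.1 h.2 ▸ hp)
        · exact hxC (h.2 ▸ p.2.1)
      have hq' : (∃ p ∈ l ++ [q], (u = p.1.1 ∧ v = p.1.2.1) ∨ (u = p.1.2.1 ∧ v = p.1.1)) ↔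
          (∃ p ∈ l, (u = p.1.1 ∧ v = p.1.2.1) ∨ (u = p.1.2.1 ∧ v = p.1.1)) ∨
          ((u = q.1.1 ∧ v = q.1.2.1) ∨ (u = q.1.2.1 ∧ v = q.1.1)) := by
        simp only [List.mem_append, List.mem_singleton, or_and_right, exists_or, exists_eq_left]
      rw [hq', ← or_assoc, ← ih₂]
      change (_ ∧ Xor _ _) ↔ _
      rw [ih₁, ih₁, subdivideCross_adj_inr_inl, subdivideCross_adj_inr_inl]
      constructor
      · rintro ⟨huv, h | ⟨⟨h₁ | h₁, h₂ | h₂⟩, -⟩⟩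
        · exact Or.inl h.1
        · exact absurd (by rw [h₁, h₂]) huv
        · exact Or.inr (Or.inl ⟨h₁, h₂⟩)
        · exact Or.inr (Or.inr ⟨h₁, h₂⟩)
        · exact absurd (by rw [h₁, h₂]) huv
      · rintro (h | ⟨h₁, h₂⟩ | ⟨h₁, h₂⟩)
        · refine ⟨h.ne, Or.inl ⟨h, ?_⟩⟩
          rintro ⟨h₁ | h₁, h₂ | h₂⟩
          · exact h.ne (by rw [h₁, h₂])
          · exact hnot h₁ h₂ h
          · exact hnot h₂ h₁ h.symm
          · exact h.ne (by rw [h₁, h₂])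
        · refine ⟨?_, Or.inr ⟨⟨Or.inl h₁, Or.inr h₂⟩, hnot h₁ h₂⟩⟩
          rw [h₁, h₂]
          exact fun h => hne (Sum.inl_injective h)
        · refine ⟨?_, Or.inr ⟨⟨Or.inr h₁, Or.inl h₂⟩, fun h => hnot h₂ h₁ h.symm⟩⟩
          rw [h₁, h₂]
          exact fun h => hne (Sum.inl_injective h).symm

instance [Finite V] : Finite (PathVertex H C I (fun _ _ => 2)) :=
  Finite.of_injective (fun p => (p.1.1, p.1.2.1)) fun _ _ h =>
    PathVertex.ext_ends (Prod.ext_iff.1 h).1 (Prod.ext_iff.1 h).2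

theorem IsSplit.isVertexMinor_subdivideCross [Finite V] (hs : H.IsSplit C I) :
    H.IsVertexMinor (H.subdivideCross C I) := by
  have := Fintype.ofFinite (PathVertex H C I (fun _ _ => 2))
  refine ⟨(Finset.univ.toList : List (PathVertex H C I (fun _ _ => 2))).map Sum.inr,
    ⟨⟨⟨Sum.inl, Sum.inl_injective⟩, ?_⟩⟩⟩
  intro u v
  change (SimpleGraph.Adj _ (Sum.inl u) (Sum.inl v)) ↔ _
  rw [(foldl_localComplement_subdivideCross hs _ (Finset.nodup_toList _)).2]
  constructor
  · rintro (h | ⟨p, -, ⟨rfl, rfl⟩ | ⟨rfl, rfl⟩⟩)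
    · exact h.1
    · exact p.2.2.2.1
    · exact p.2.2.2.1.symm
  · intro h
    rcases hs.mem_or_mem u with hu | hu <;> rcases hs.mem_or_mem v with hv | hv
    · exact Or.inl ⟨h, hu, hv⟩
    · exact Or.inr ⟨⟨(u, v, 1), hu, hv, h, one_pos, one_lt_two⟩,
        Finset.mem_toList.2 (Finset.mem_univ _), Or.inl ⟨rfl, rfl⟩⟩
    · exact Or.inr ⟨⟨(v, u, 1), hv, hu, h.symm, one_pos, one_lt_two⟩,
        Finset.mem_toList.2 (Finset.mem_univ _), Or.inr ⟨rfl, rfl⟩⟩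
    · exact absurd h (hs.isIndepSet hu hv h.ne)

end SubdivideCross

/-! ### Existence of clique expressions. -/

section CliqueExpr

variable {k : ℕ}

theorem CliqueExpr.exists_eval_eq_bot (s : Finset (Fin k)) (hs : s.Nonempty) :
    ∃ e : CliqueExpr k, Function.Injective e.eval.label ∧ Set.range e.eval.label = s ∧
      ∀ a b, ¬ e.eval.graph.Adj a b := by
  induction hs using Finset.Nonempty.cons_induction with
  | singleton i =>
    refine ⟨.single i, fun _ _ _ => rfl, ?_, fun _ _ h => h⟩
    rw [Finset.coe_singleton]
    exact Set.range_const (ι := Unit)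
  | cons i s hi hs ih =>
    obtain ⟨e, h₁, h₂, h₃⟩ := ih
    refine ⟨.disjointUnion (.single i) e, ?_, ?_, ?_⟩
    · refine Function.Injective.sumElim (fun _ _ _ => rfl) h₁ fun a b h => hi ?_
      rw [← Finset.mem_coe, ← h₂]
      exact ⟨b, h.symm⟩
    · change Set.range (Sum.elim (fun _ : Unit => i) e.eval.label) = _
      rw [Set.Sum.elim_range, h₂, Set.range_const]
      simp
    · rintro (a | a) (b | b) h
      · exact h
      · cases h
      · cases h
      · exact h₃ a b h

/-- While all labels are distinct, each join adds at most one edge. -/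
theorem CliqueExpr.exists_eval_adj_iff (hk : 0 < k) (E : Finset (Fin k × Fin k))
    (hE : ∀ p ∈ E, p.1 ≠ p.2) :
    ∃ e : CliqueExpr k, Function.Bijective e.eval.label ∧
      ∀ a b, e.eval.graph.Adj a b ↔
        (e.eval.label a, e.eval.label b) ∈ E ∨ (e.eval.label b, e.eval.label a) ∈ E := by
  induction E using Finset.induction_on with
  | empty =>
    obtain ⟨e, h₁, h₂, h₃⟩ := exists_eval_eq_bot (Finset.univ : Finset (Fin k)) ⟨⟨0, hk⟩, by simp⟩
    exact ⟨e, ⟨h₁, Set.range_eq_univ.1 (by simpa using h₂)⟩, by simpa using h₃⟩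
  | insert p E hp ih =>
    obtain ⟨e, h₁, h₂⟩ := ih fun q hq => hE q (Finset.mem_insert_of_mem hq)
    refine ⟨.join p.1 p.2 (hE p (Finset.mem_insert_self _ _)) e, h₁, fun a b => ?_⟩
    change (e.eval.graph.Adj a b ∨ _) ↔ (e.eval.label a, e.eval.label b) ∈ _ ∨
      (e.eval.label b, e.eval.label a) ∈ _
    refine (or_congr_left (h₂ a b)).trans ?_
    simp only [Finset.mem_insert, Prod.ext_iff]
    tauto

/-- Ensures that the infimum defining `cliqueWidth` is attained and is not the default value `0`. -/
theorem exists_hasCliqueExpr {W : Type u} [Finite W] [Nonempty W] (G : SimpleGraph W) :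
    ∃ k, G.HasCliqueExpr k := by
  classical
  obtain ⟨k, ⟨φ⟩⟩ := Finite.exists_equiv_fin W
  have hk : 0 < k := (φ (Classical.arbitrary W)).pos
  obtain ⟨e, h₁, h₂⟩ := CliqueExpr.exists_eval_adj_iff hk
    (Finset.univ.filter fun p : Fin k × Fin k => G.Adj (φ.symm p.1) (φ.symm p.2))
    (by
      intro p hp h
      rw [Finset.mem_filter, h] at hp
      exact hp.2.ne rfl)
  refine ⟨k, e, ⟨(φ.trans (Equiv.ofBijective _ h₁).symm), ?_⟩⟩
  intro a b
  have hlab : ∀ a, e.eval.label ((φ.trans (Equiv.ofBijective _ h₁).symm) a) = φ a := fun a =>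
    Equiv.ofBijective_apply_symm_apply _ h₁ _
  rw [h₂, hlab, hlab]
  simp [G.adj_comm b a]

/-! ### Balanced cuts with few classes. -/

/-- The vertices of `S` fall into at most `k` classes, the members of a class having the same
neighbours outside `S`. -/
def HasCutClasses {W : Type u} (G : SimpleGraph W) (S : Set W) (k : ℕ) : Prop :=
  ∃ lab : W → Fin k, ∀ a ∈ S, ∀ b ∈ S, lab a = lab b → ∀ v ∉ S, (G.Adj a v ↔ G.Adj b v)

open scoped Classical in
theorem card_filter_mem_image_inl {α β : Type*} (T : Finset (α ⊕ β)) (S : Set α) :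
    (T.filter (· ∈ (Sum.inl '' S : Set (α ⊕ β)))).card = (T.toLeft.filter (· ∈ S)).card := by
  rw [← Finset.card_map (Function.Embedding.inl : _ ↪ α ⊕ β) (s := T.toLeft.filter (· ∈ S))]
  congr 1
  ext (a | a) <;> simp

open scoped Classical in
theorem card_filter_mem_image_inr {α β : Type*} (T : Finset (α ⊕ β)) (S : Set β) :
    (T.filter (· ∈ (Sum.inr '' S : Set (α ⊕ β)))).card = (T.toRight.filter (· ∈ S)).card := by
  rw [← Finset.card_map (Function.Embedding.inr : _ ↪ α ⊕ β) (s := T.toRight.filter (· ∈ S))]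
  congr 1
  ext (a | a) <;> simp

-- Descend into a side of a disjoint union while it has more than `m` points of `T`. Where neither
-- side does, the whole vertex set has at most `2 * m` points and its labels give the classes.
-- Equality of the current labels is carried along so that later joins treat a class uniformly.
open scoped Classical in
theorem CliqueExpr.exists_balanced {m : ℕ} (hm : 0 < m) (e : CliqueExpr k)
    (T : Finset e.eval.Vert) (hT : m < T.card) :
    ∃ S : Set e.eval.Vert, m < (T.filter (· ∈ S)).card ∧ (T.filter (· ∈ S)).card ≤ 2 * m ∧
      ∃ lab : e.eval.Vert → Fin k, ∀ a ∈ S, ∀ b ∈ S, lab a = lab b →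
        e.eval.label a = e.eval.label b ∧
          ∀ v ∉ S, (e.eval.graph.Adj a v ↔ e.eval.graph.Adj b v) := by
  induction e with
  | single i =>
    have : T.card ≤ 1 := Finset.card_le_one.2 fun _ _ _ _ => rfl
    omega
  | join i j hij e ih =>
    obtain ⟨S, h₁, h₂, lab, h₃⟩ := ih T hT
    refine ⟨S, h₁, h₂, lab, fun a ha b hb hab => ?_⟩
    obtain ⟨h₄, h₅⟩ := h₃ a ha b hb hab
    refine ⟨h₄, fun v hv => ?_⟩
    change (e.eval.graph.Adj a v ∨ _) ↔ (e.eval.graph.Adj b v ∨ _)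
    rw [h₅ v hv, h₄]
  | relabel i j e ih =>
    obtain ⟨S, h₁, h₂, lab, h₃⟩ := ih T hT
    refine ⟨S, h₁, h₂, lab, fun a ha b hb hab => ?_⟩
    obtain ⟨h₄, h₅⟩ := h₃ a ha b hb hab
    refine ⟨?_, h₅⟩
    change (if e.eval.label a = i then j else e.eval.label a) =
      (if e.eval.label b = i then j else e.eval.label b)
    rw [h₄]
  | disjointUnion e f ihe ihf =>
    change Finset (e.eval.Vert ⊕ f.eval.Vert) at T
    have hcard : T.toLeft.card + T.toRight.card = T.card := Finset.card_toLeft_add_card_toRight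
    by_cases hl : m < T.toLeft.card
    · obtain ⟨S, h₁, h₂, lab, h₃⟩ := ihe _ hl
      have hS : (T.filter (· ∈ (Sum.inl '' S : Set (e.eval.Vert ⊕ f.eval.Vert)))).card =
          (T.toLeft.filter (· ∈ S)).card := card_filter_mem_image_inl T S
      refine ⟨Sum.inl '' S, hS ▸ h₁, hS ▸ h₂, Sum.elim lab f.eval.label, ?_⟩
      rintro _ ⟨a, ha, rfl⟩ _ ⟨b, hb, rfl⟩ hab
      obtain ⟨h₄, h₅⟩ := h₃ a ha b hb hab
      refine ⟨h₄, ?_⟩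
      rintro (v | v) hv
      · exact h₅ v fun h => hv ⟨v, h, rfl⟩
      · exact Iff.rfl
    by_cases hr : m < T.toRight.card
    · obtain ⟨S, h₁, h₂, lab, h₃⟩ := ihf _ hr
      have hS : (T.filter (· ∈ (Sum.inr '' S : Set (e.eval.Vert ⊕ f.eval.Vert)))).card =
          (T.toRight.filter (· ∈ S)).card := card_filter_mem_image_inr T S
      refine ⟨Sum.inr '' S, hS ▸ h₁, hS ▸ h₂, Sum.elim e.eval.label lab, ?_⟩
      rintro _ ⟨a, ha, rfl⟩ _ ⟨b, hb, rfl⟩ hab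
      obtain ⟨h₄, h₅⟩ := h₃ a ha b hb hab
      refine ⟨h₄, ?_⟩
      rintro (v | v) hv
      · exact Iff.rfl
      · exact h₅ v fun h => hv ⟨v, h, rfl⟩
    · have hS : ∀ S : Set (e.eval.Vert ⊕ f.eval.Vert), S = Set.univ →
          (T.filter (· ∈ S)).card = T.card := by
        rintro S hS
        rw [Finset.filter_true_of_mem fun x _ => hS ▸ Set.mem_univ x]
      refine ⟨Set.univ, ?_, ?_, (CliqueExpr.disjointUnion e f).eval.label,
        fun a _ b _ hab => ⟨hab, fun v hv => absurd (Set.mem_univ v) hv⟩⟩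
      · exact hT.trans_eq (hS _ rfl).symm
      · refine (hS _ rfl).trans_le ?_
        omega

open scoped Classical in
theorem HasCliqueExpr.exists_balanced {W : Type u} {G : SimpleGraph W} (hG : G.HasCliqueExpr k)
    {m : ℕ} (hm : 0 < m) (T : Finset W) (hT : m < T.card) :
    ∃ S : Set W, m < (T.filter (· ∈ S)).card ∧ (T.filter (· ∈ S)).card ≤ 2 * m ∧
      G.HasCutClasses S k := by
  obtain ⟨e, ⟨φ⟩⟩ := hG
  obtain ⟨S, h₁, h₂, lab, h₃⟩ := e.exists_balanced hm (T.map φ.toEquiv.toEmbedding)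
    (by rwa [Finset.card_map])
  have hS : (T.filter (· ∈ φ ⁻¹' S)).card =
      ((T.map φ.toEquiv.toEmbedding).filter (· ∈ S)).card := by
    rw [Finset.filter_map, Finset.card_map]
    rfl
  refine ⟨φ ⁻¹' S, hS ▸ h₁, hS ▸ h₂, lab ∘ φ, fun a ha b hb hab v hv => ?_⟩
  have := (h₃ _ ha _ hb hab).2 (φ v) hv
  rwa [φ.map_adj_iff, φ.map_adj_iff] at this

/-- If each hub `h i` is adjacent to its own spokes `s i j` but to no other spoke, then a cut with
few classes splits few of the sets formed by a hub and its spokes. -/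
theorem HasCutClasses.card_split_le {W : Type u} {G : SimpleGraph W} {S : Set W}
    (hS : G.HasCutClasses S k) {ι κ : Type*} [Finite ι] (h : ι → W) (s : ι → κ → W)
    (hadj : ∀ i i' j, G.Adj (h i) (s i' j) ↔ i = i') :
    {i | ∃ j, ¬ (s i j ∈ S ↔ h i ∈ S)}.ncard ≤ 2 * k := by
  obtain ⟨lab, hlab⟩ := hS
  -- A spoke outside `S` separates its hub from all other hubs, so these hubs lie in distinct
  -- classes.
  have h₁ : {i | h i ∈ S ∧ ∃ j, s i j ∉ S}.ncard ≤ k := by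
    rw [← Set.InjOn.ncard_image (f := fun i => lab (h i))]
    · exact (Set.ncard_le_card _).trans_eq (by simp)
    · rintro i ⟨hi, j, hj⟩ i' ⟨hi', -⟩ heq
      exact ((hadj i' i j).1 ((hlab _ hi _ hi' heq _ hj).1 ((hadj i i j).2 rfl))).symm
  -- Roles reversed: the hub outside `S` separates one chosen spoke per index.
  have h₂ : {i | h i ∉ S ∧ ∃ j, s i j ∈ S}.ncard ≤ k := by
    rcases isEmpty_or_nonempty κ with hκ | hκ
    · simp
    have hch : ∀ i, ∃ j, (∃ j', s i j' ∈ S) → s i j ∈ S := fun i => by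
      by_cases hi : ∃ j', s i j' ∈ S
      · exact ⟨hi.choose, fun _ => hi.choose_spec⟩
      · exact ⟨Classical.arbitrary κ, fun hi' => absurd hi' hi⟩
    choose g hg using hch
    rw [← Set.InjOn.ncard_image (f := fun i => lab (s i (g i)))]
    · exact (Set.ncard_le_card _).trans_eq (by simp)
    · rintro i ⟨hi, hj⟩ i' ⟨hi', hj'⟩ heq
      exact (hadj i i' _).1
        ((hlab _ (hg i hj) _ (hg i' hj') heq _ hi).1 ((hadj i i _).2 rfl).symm).symm
  calc _ ≤ ({i | h i ∈ S ∧ ∃ j, s i j ∉ S} ∪ {i | h i ∉ S ∧ ∃ j, s i j ∈ S}).ncard := by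
        refine Set.ncard_le_ncard ?_ (Set.toFinite _)
        rintro i ⟨j, hj⟩
        by_cases hi : h i ∈ S
        · exact Or.inl ⟨hi, j, fun h' => hj ⟨fun _ => hi, fun _ => h'⟩⟩
        · exact Or.inr ⟨hi, j, by_contra fun h' => hj ⟨fun h'' => absurd h'' h',
            fun h'' => absurd h'' hi⟩⟩
    _ ≤ _ := Set.ncard_union_le _ _
    _ ≤ 2 * k := by omega

end CliqueExpr

/-! ### The lower bound for complete splitgraphs. -/

/-- If few rows and few columns of a square array fail to be constant, then one of the two values
is rare. -/
theorem ncard_le_of_few_split {n d : ℕ} (hn : d < n) (P : Fin n → Fin n → Prop)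
    (r c : Fin n → Prop) (hr : {i | ∃ j, ¬ (P i j ↔ r i)}.ncard ≤ d)
    (hc : {j | ∃ i, ¬ (P i j ↔ c j)}.ncard ≤ d) :
    {q : Fin n × Fin n | P q.1 q.2}.ncard ≤ d * d ∨
      {q : Fin n × Fin n | ¬ P q.1 q.2}.ncard ≤ d * d := by
  set R := {i | ∃ j, ¬ (P i j ↔ r i)} with hR
  set Q := {j | ∃ i, ¬ (P i j ↔ c j)} with hQ
  have hex : ∀ A : Set (Fin n), A.ncard ≤ d → ∃ i, i ∉ A := by
    intro A hA
    by_contra! h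
    rw [Set.eq_univ_of_forall h, Set.ncard_univ, Nat.card_fin] at hA
    omega
  obtain ⟨i₀, hi₀⟩ := hex R hr
  obtain ⟨j₀, hj₀⟩ := hex Q hc
  have hrow : ∀ i ∉ R, ∀ j, P i j ↔ r i := fun i hi j => by
    by_contra h
    exact hi ⟨j, h⟩
  have hcol : ∀ j ∉ Q, ∀ i, P i j ↔ c j := fun j hj i => by
    by_contra h
    exact hj ⟨i, h⟩
  -- A constant row is compared with `(i₀, j₀)` through column `j₀`, a constant column through row
  -- `i₀`.
  have hP : ∀ i j, ¬ (P i j ↔ P i₀ j₀) → i ∈ R ∧ j ∈ Q := by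
    intro i j h
    constructor <;> by_contra h'
    · exact h (by rw [hrow i h', ← hrow i h' j₀, hcol j₀ hj₀, hcol j₀ hj₀])
    · exact h (by rw [hcol j h', ← hcol j h' i₀, hrow i₀ hi₀, hrow i₀ hi₀])
  have hbound : ∀ A : Set (Fin n × Fin n), A ⊆ R ×ˢ Q → A.ncard ≤ d * d := fun A hA =>
    (Set.ncard_le_ncard hA (Set.toFinite _)).trans
      ((Set.ncard_prod).trans_le (Nat.mul_le_mul hr hc))
  by_cases h₀ : P i₀ j₀
  · exact Or.inr (hbound _ fun q hq => hP _ _ fun h => hq (h.2 h₀))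
  · exact Or.inl (hbound _ fun q hq => hP _ _ fun h => h₀ (h.1 hq))

/-- The complete splitgraph: every vertex of the clique is adjacent to all other vertices. -/
def completeSplit (n : ℕ) : SimpleGraph (Fin n ⊕ Fin n) where
  Adj a b := a ≠ b ∧ (a.isLeft ∨ b.isLeft)
  symm := ⟨fun _ _ h => ⟨h.1.symm, h.2.symm⟩⟩
  loopless := ⟨fun _ h => h.1 rfl⟩

theorem isSplit_completeSplit (n : ℕ) :
    (completeSplit n).IsSplit (Set.range Sum.inl) (Set.range Sum.inr) where
  isCompl := Set.isCompl_range_inl_range_inr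
  isClique := by
    rintro _ ⟨a, rfl⟩ _ ⟨b, rfl⟩ h
    exact ⟨h, Or.inl rfl⟩
  isIndepSet := by
    rintro _ ⟨a, rfl⟩ _ ⟨b, rfl⟩ h h'
    simpa using h'.2

/-- The vertex that subdivides the edge between the `i`-th vertex of the clique and the `j`-th
vertex of the independent set. -/
def completeSplitMid {n : ℕ} (i j : Fin n) : (Fin n ⊕ Fin n) ⊕
    PathVertex (completeSplit n) (Set.range Sum.inl) (Set.range Sum.inr) (fun _ _ => 2) :=
  .inr ⟨(.inl i, .inr j, 1), ⟨i, rfl⟩, ⟨j, rfl⟩, ⟨by simp, Or.inl rfl⟩, one_pos, one_lt_two⟩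

theorem adj_completeSplitMid {n : ℕ} {i j : Fin n} {u : Fin n ⊕ Fin n} :
    ((completeSplit n).subdivideCross (Set.range Sum.inl) (Set.range Sum.inr)).Adj
      (completeSplitMid i j) (.inl u) ↔ u = .inl i ∨ u = .inr j :=
  subdivideCross_adj_inr_inl

theorem lt_of_hasCliqueExpr_completeSplit {t k : ℕ}
    (h : ((completeSplit (4 * t + 4)).subdivideCross (Set.range Sum.inl)
      (Set.range Sum.inr)).HasCliqueExpr k) : t < k := by
  classical
  by_contra! hk
  set n := 4 * t + 4 with hn
  set s : Fin n → Fin n → _ := completeSplitMid with hs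
  have hinj : Function.Injective fun q : Fin n × Fin n => s q.1 q.2 := by
    rintro ⟨i, j⟩ ⟨i', j'⟩ h
    have := congrArg Subtype.val (Sum.inr_injective h)
    simpa using this
  let F : Fin n × Fin n ↪ _ := ⟨_, hinj⟩
  have hcard : (Finset.univ.map F).card = n * n := by simp
  -- With this `m`, both sides exceed `4 * t * t` entries: `S` has more than `m`, its complement at
  -- least `n * n - 2 * m`.
  obtain ⟨S, h₁, h₂, hS⟩ := h.exists_balanced (m := 4 * t * t + 1) (by omega)
    (Finset.univ.map F) (by rw [hcard]; nlinarith)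
  have hrow := hS.card_split_le (fun i => .inl (.inl i)) s fun i i' j => by
    rw [adj_comm, hs, adj_completeSplitMid]
    simp
  have hcol := hS.card_split_le (fun j => .inl (.inr j)) (fun j i => s i j) fun i i' j => by
    rw [adj_comm, hs, adj_completeSplitMid]
    simp
  have hP : ((Finset.univ.map F).filter (· ∈ S)).card =
      {q : Fin n × Fin n | s q.1 q.2 ∈ S}.ncard := by
    rw [Finset.filter_map, Finset.card_map, Set.ncard_eq_toFinset_card']
    congr 1
    ext q
    simp [F]
  have hsum := Set.ncard_add_ncard_compl {q : Fin n × Fin n | s q.1 q.2 ∈ S}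
  rw [Nat.card_prod, Nat.card_fin] at hsum
  have hcompl : {q : Fin n × Fin n | s q.1 q.2 ∈ S}ᶜ = {q | ¬ s q.1 q.2 ∈ S} := rfl
  rw [hcompl] at hsum
  have hkt : 2 * k * (2 * k) ≤ 4 * t * t := by nlinarith
  rcases ncard_le_of_few_split (d := 2 * k) (by omega) (fun i j => s i j ∈ S) _ _ hrow hcol
    with h | h
  · omega
  · have : n * n = 16 * t * t + 32 * t + 16 := by rw [hn]; ring
    have : 16 * t * t = 4 * (4 * t * t) := by ring
    omega

theorem lt_cliqueWidth_completeSplit (t : ℕ) :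
    t < ((completeSplit (4 * t + 4)).subdivideCross (Set.range Sum.inl)
      (Set.range Sum.inr)).cliqueWidth := by
  have : Nonempty ((Fin (4 * t + 4) ⊕ Fin (4 * t + 4)) ⊕ PathVertex (completeSplit (4 * t + 4))
    (Set.range Sum.inl) (Set.range Sum.inr) (fun _ _ => 2)) := ⟨.inl (.inl 0)⟩
  exact lt_of_hasCliqueExpr_completeSplit (Nat.sInf_mem (exists_hasCliqueExpr _))

end SimpleGraph

theorem mainTheorem4 (t : ℕ) :
    ∃ (V : Type) (_ : Finite V) (H : SimpleGraph V) (C I : Set V),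
      H.IsSplit C I ∧
      (H.subdivideCross C I).IsBirdcageSplit ∧
      ¬ (H.subdivideCross C I).HasEvenHole ∧
      ¬ (H.subdivideCross C I).HasDiamond ∧
      t < (H.subdivideCross C I).cliqueWidth ∧
      H.IsVertexMinor (H.subdivideCross C I) := by
  have hs := SimpleGraph.isSplit_completeSplit (4 * t + 4)
  exact ⟨_, inferInstance, _, _, _, hs, hs.isBirdcageSplit_subdivideCross,
    hs.not_hasEvenHole_subdivideCross, hs.not_hasDiamond_subdivideCross,
    SimpleGraph.lt_cliqueWidth_completeSplit t, hs.isVertexMinor_subdivideCross⟩
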